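/- **Setting.** Let $\mathbb K$ be a countable set and $\Sigma$ a set of internal states. For a set $C$, the name algebra $\mathcal N[C]$ consists of the terms $u,v::=c\mid u.t\mid u\vee v$ ($c\in C$, $t\in\{l,r\}^*$) modulo the congruence generated by $(u\vee v).l=u$, $(u\vee v).r=v$, $u.\varepsilon=u$, $(u.s).t=u.(st)$ and $u.l\vee u.r=u$. Put $\mathcal V:=\mathcal N[\mathbb K\sqcup -\mathbb K]$, where $-\mathbb K$ is a disjoint copy of $\mathbb K$. For $V\subseteq\mathcal V$ let $\mathcal N[V]\subseteq\mathcal V$ be the smallest set that contains $V$ and is closed under $u\mapsto u.t$ and $(u,v)\mapsto u\vee v$; write $V\mathrel{\hat=}V'$ if $\mathcal N[V]=\mathcal N[V']$. A graph is a finite set $G\subseteq\Sigma\times\mathcal V$ such that $(\sigma,v),(\sigma',v')\in G$ and $v.t=v'.t'$ imply $\sigma=\sigma'$, $v=v'$ and $t=t'$; its support is $V(G)=\{v\mid(\sigma,v)\in G\}$. Let $\mathcal G$ be the set of all graphs and $\mathcal H=\ell^2(\mathcal G)$ the Hilbert space with canonical orthonormal basis $(|G\rangle)_{G\in\mathcal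 G}$. A restriction is a map $\chi:\mathcal G\to\mathcal G$, $G\mapsto G_\chi\subseteq G$, such that $G_\chi\subseteq H\subseteq G$ implies $H_\chi=G_\chi$; write $G_{\overline\chi}:=G\setminus G_\chi$. For a trace class operator $\rho$ on $\mathcal H$, the partial trace $\rho_{|\chi}$ is the trace class operator obtained from $(|G\rangle\langle H|)_{|\chi}:=|G_\chi\rangle\langle H_\chi|\,\langle H_{\overline\chi}|G_{\overline\chi}\rangle$ by linear extension, i.e. with matrix elements $$\langle X|\rho_{|\chi}|Y\rangle=\sum_{G,H\in\mathcal G}\langle G|\rho|H\rangle\,\langle X|G_\chi\rangle\,\langle H_\chi|Y\rangle\,\langle H_{\overline\chi}|G_{\overline\chi}\rangle$$ (an absolutely convergent sum). A bounded operator $A$ on $\mathcal H$ is *name-preserving* if $\langle H|A|G\rangle=0$ whenever $V(G)\mathrel{\hat=}V(H)$ fails. It is *$\chi$-local* if $\langle H|A|G\rangle=\langle H_\chi|A|G_\chi\rangle\langle H_{\overline\chi}|G_{\overline\chi}\rangle$ for all $G,H\in\mathcal G$, and *strictly $\chi$-local* if $A$, $A^\dagger A$ and $AA^\dagger$ are all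 $\chi$-local. For restrictions $\chi,\zeta$, a bounded operator $U$ is *$\chi\zeta$-causal* if $$(U\rho U^\dagger)_{|\zeta}=(U\rho_{|\chi}U^\dagger)_{|\zeta}\qquad(*)$$ for every trace class $\rho$, and *name-preserving $\chi\zeta$-causal* if $U$ is name-preserving and $(*)$ holds for every name-preserving trace class $\rho$. **Proposition (Dual causality).** Let $\chi,\zeta$ be restrictions and $U$ a bounded operator on $\mathcal H$. 1. $U$ is $\chi\zeta$-causal if and only if $U^\dagger AU$ is $\chi$-local for every $\zeta$-local bounded operator $A$. 2. $U$ is name-preserving $\chi\zeta$-causal if and only if $U$ is name-preserving and $U^\dagger AU$ is name-preserving and $\chi$-local for every name-preserving $\zeta$-local bounded operator $A$. 3. If $U$ is unitary and $\chi\zeta$-causal, then $U^\dagger AU$ is strictly $\chi$-local for every strictly $\zeta$-local bounded operator $A$. 4. If $U$ is unitary and name-preserving $\chi\zeta$-causal, then $U^\dagger AU$ is name-preserving and strictly $\chi$-local for every name-preserving strictly $\zeta$-local bounded operator $A$. -/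

import Mathlib

noncomputable section

namespace QNet

/-! ### Name algebra -/

/-- The two letters `l` and `r`; words `t ∈ {l, r}*` are lists of letters. -/
inductive Letter : Type
  | l
  | r

/-- Terms `u, v ::= c | u.t | u ∨ v` over a set `C` of constants. -/
inductive NameTerm (C : Type*) : Type _
  | const (c : C) : NameTerm C
  | dot (u : NameTerm C) (t : List Letter) : NameTerm C
  | join (u v : NameTerm C) : NameTerm C

/-- The equality theory of names: the least congruence that contains the displayed equations
(`dot_dot` says that `u.t` is the successive application of the letters of the word `t`). -/
inductive NameTerm.Equiv {C : Type*} : NameTerm C → NameTerm C → Prop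
  | refl (u) : Equiv u u
  | symm {u v} : Equiv u v → Equiv v u
  | trans {u v w} : Equiv u v → Equiv v w → Equiv u w
  | dot_congr {u v} (t) : Equiv u v → Equiv (.dot u t) (.dot v t)
  | join_congr {u u' v v'} : Equiv u u' → Equiv v v' → Equiv (.join u v) (.join u' v')
  | join_l (u v) : Equiv (.dot (.join u v) [Letter.l]) u
  | join_r (u v) : Equiv (.dot (.join u v) [Letter.r]) v
  | dot_nil (u) : Equiv (.dot u []) u
  | dot_dot (u s t) : Equiv (.dot (.dot u s) t) (.dot u (s ++ t))
  | join_dot (u) : Equiv (.join (.dot u [Letter.l]) (.dot u [Letter.r])) u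

/-- The setoid of provable equality of terms. -/
def NameTerm.setoid (C : Type*) : Setoid (NameTerm C) :=
  ⟨NameTerm.Equiv, .refl, .symm, .trans⟩

/-- The name algebra `𝒩[C]`. -/
def NameAlg (C : Type*) : Type _ := Quotient (NameTerm.setoid C)

/-- The name of a constant. -/
def NameAlg.const {C : Type*} (c : C) : NameAlg C := Quotient.mk _ (.const c)

/-- The operation `u ↦ u.t`. -/
def NameAlg.dot {C : Type*} (u : NameAlg C) (t : List Letter) : NameAlg C :=
  Quotient.map' (s₁ := NameTerm.setoid C) (s₂ := NameTerm.setoid C)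
    (fun x => NameTerm.dot x t) (fun _ _ h => NameTerm.Equiv.dot_congr t h) u

/-- The operation `u ∨ v`. -/
def NameAlg.join {C : Type*} (u v : NameAlg C) : NameAlg C :=
  Quotient.map₂ (sa := NameTerm.setoid C) (sb := NameTerm.setoid C) (sc := NameTerm.setoid C)
    NameTerm.join (fun _ _ h _ _ h' => NameTerm.Equiv.join_congr h h') u v

/-- Vertex names `𝒱 = 𝒩[𝕂 ∪ -𝕂]`; `Sum.inl c` is `c` and `Sum.inr c` is `-c`. -/
abbrev Vertex (K : Type*) : Type _ := NameAlg (K ⊕ K)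

/-- `𝒩[V]` for a set `V` of names: the names built from `V` with the two operations. -/
inductive Generated {C : Type*} (V : Set (NameAlg C)) : NameAlg C → Prop
  | mem {v} : v ∈ V → Generated V v
  | dot {u} (t) : Generated V u → Generated V (u.dot t)
  | join {u v} : Generated V u → Generated V v → Generated V (u.join v)

/-- `V ≙ V'`, that is `𝒩[V] = 𝒩[V']`. -/
def SameNames {C : Type*} (V V' : Set (NameAlg C)) : Prop :=
  {u | Generated V u} = {u | Generated V' u}

/-! ### Graphs and restrictions -/

/-- A graph over the internal states `S` and the names `𝒩[K ∪ -K]`: a finite set of well-named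
systems `(σ, v)`. -/
@[ext]
structure Graph (K S : Type*) where
  /-- The systems of the graph. -/
  systems : Set (S × Vertex K)
  finite : systems.Finite
  wellNamed : ∀ a ∈ systems, ∀ b ∈ systems, ∀ t t' : List Letter,
    a.2.dot t = b.2.dot t' → a.1 = b.1 ∧ a.2 = b.2 ∧ t = t'

/-- The support `V(G)`. -/
def Graph.support {K S : Type*} (G : Graph K S) : Set (Vertex K) := Prod.snd '' G.systems

/-- A restriction `χ : G ↦ G_χ ⊆ G`. -/
structure Restriction (K S : Type*) where
  /-- The map `G ↦ G_χ`. -/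
  res : Graph K S → Graph K S
  res_subset : ∀ G, (res G).systems ⊆ G.systems
  res_eq : ∀ G H : Graph K S, (res G).systems ⊆ H.systems → H.systems ⊆ G.systems →
    res H = res G

/-- The complement `G \ G_χ`. -/
def Restriction.compl {K S : Type*} (χ : Restriction K S) (G : Graph K S) : Graph K S where
  systems := G.systems \ (χ.res G).systems
  finite := G.finite.subset Set.sdiff_subset
  wellNamed := fun a ha b hb => G.wellNamed a ha.1 b hb.1

/-! ### Operators -/

/-- The Hilbert space `ℓ²(ι)` with canonical orthonormal basis labelled by `ι`. -/
abbrev Hilb (ι : Type*) : Type _ := lp (fun _ : ι => ℂ) 2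

/-- Bounded operators. -/
abbrev Op (ι : Type*) : Type _ := Hilb ι →L[ℂ] Hilb ι

open Classical in
/-- The basis vector `|i⟩`. -/
def ket {ι : Type*} (i : ι) : Hilb ι := lp.single 2 i (1 : ℂ)

/-- `⟨i|j⟩`. -/
def braket {ι : Type*} (i j : ι) : ℂ := inner ℂ (ket i) (ket j)

/-- `⟨i|A|j⟩`. -/
def elem {ι : Type*} (A : Op ι) (i j : ι) : ℂ := inner ℂ (ket i) (A (ket j))

/-- The absolute value `|T| = (T† T)^(1/2)` of a bounded operator. -/
def absOp {H : Type*} [NormedAddCommGroup H] [InnerProductSpace ℂ H] [CompleteSpace H]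
    (T : H →L[ℂ] H) : H →L[ℂ] H := CFC.abs T

/-- `T` is trace class: the sum of the diagonal elements of `|T|` is finite. -/
def IsTraceClass {ι : Type*} (T : Op ι) : Prop :=
  Summable fun i => (elem (absOp T) i i).re

/-- Trace class operators. -/
abbrev TraceClass (ι : Type*) : Type _ := {T : Op ι // IsTraceClass T}

/-- The Hilbert space of graphs is `Hilb (Graph K S)`; an operator is name-preserving if it has no
matrix element between graphs whose supports generate different names. -/
def IsNamePreserving {K S : Type*} (A : Op (Graph K S)) : Prop :=
  ∀ G H : Graph K S, ¬ SameNames G.support H.support → elem A H G = 0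

/-- `χ`-locality. -/
def IsLocal {K S : Type*} (χ : Restriction K S) (A : Op (Graph K S)) : Prop :=
  ∀ G H : Graph K S,
    elem A H G = elem A (χ.res H) (χ.res G) * braket (χ.compl H) (χ.compl G)

/-- Strict `χ`-locality. -/
def IsStrictlyLocal {K S : Type*} (χ : Restriction K S) (A : Op (Graph K S)) : Prop :=
  IsLocal χ A ∧ IsLocal χ (star A * A) ∧ IsLocal χ (A * star A)

/-! ### Auxiliary facts on trace class operators -/

section Aux

theorem hasSum_of_eq {α : Type*} {f g : α → ℂ} {a : ℂ} (h : HasSum f a)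
    (hfg : ∀ i, g i = f i) : HasSum g a := (funext hfg : g = f) ▸ h

variable {ι : Type*}

theorem inner_ket (i : ι) (x : Hilb ι) : inner ℂ (ket i) x = x i := by
  classical
  rw [ket, lp.inner_single_left]
  simp

theorem inner_ket_right (i : ι) (x : Hilb ι) : inner ℂ x (ket i) = star (x i) := by
  rw [← inner_conj_symm, inner_ket]
  rfl

open Classical in
theorem braket_eq (i j : ι) : braket i j = if i = j then 1 else 0 := by
  rw [braket, inner_ket, ket, lp.single_apply, Pi.single_apply]

theorem hasSum_norm_sq (x : Hilb ι) : HasSum (fun i => ‖x i‖ ^ 2) (‖x‖ ^ 2) := by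
  have h := lp.hasSum_norm (p := 2) (by norm_num) x
  simpa using h

/-- A weakly convergent decomposition `T = ∑ |x m⟩⟨y m|` with square-summable norms. -/
def IsDecomp {M : Type*} (T : Op ι) (x y : M → Hilb ι) : Prop :=
  (Summable fun m => ‖x m‖ ^ 2) ∧ (Summable fun m => ‖y m‖ ^ 2) ∧
    ∀ u v : Hilb ι, HasSum (fun m => inner ℂ u (x m) * inner ℂ (y m) v) (inner ℂ u (T v))

/-- If `‖f x‖ ≤ ‖e x‖` for all `x`, then `f` factors through `e`. -/
theorem exists_factor (f e : Op ι) (h : ∀ x, ‖f x‖ ≤ ‖e x‖) : ∃ W : Op ι, W * e = f := by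
  let R : Submodule ℂ (Hilb ι) := (LinearMap.range e.toLinearMap).topologicalClosure
  have : CompleteSpace R :=
    (LinearMap.range e.toLinearMap).isClosed_topologicalClosure.completeSpace_coe
  have hR : ∀ x, e x ∈ R := fun x =>
    (LinearMap.range e.toLinearMap).le_topologicalClosure ⟨x, rfl⟩
  let e' : Hilb ι →ₗ[ℂ] R := e.toLinearMap.codRestrict R hR
  have hd : DenseRange e' := by
    intro y
    rw [Metric.mem_closure_iff]
    intro ε hε
    have hy : (y : Hilb ι) ∈ closure (LinearMap.range e.toLinearMap : Set (Hilb ι)) := y.2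
    obtain ⟨_, ⟨x, rfl⟩, hx⟩ := Metric.mem_closure_iff.1 hy ε hε
    exact ⟨e' x, ⟨x, rfl⟩, hx⟩
  have hn : ∃ C : ℝ, ∀ x, ‖f.toLinearMap x‖ ≤ C * ‖e' x‖ :=
    ⟨1, fun x => by simpa [e'] using h x⟩
  refine ⟨(f.toLinearMap.extendOfNorm e') ∘L R.orthogonalProjectionOnto, ?_⟩
  ext1 x
  have h1 : R.orthogonalProjectionOnto (e x) = e' x :=
    Submodule.orthogonalProjectionOnto_mem_subspace_eq_self (K := R) ⟨e x, hR x⟩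
  change (f.toLinearMap.extendOfNorm e') (R.orthogonalProjectionOnto (e x)) = f x
  rw [h1]
  exact LinearMap.extendOfNorm_eq hd hn x

theorem absOp_facts {H : Type*} [NormedAddCommGroup H] [InnerProductSpace ℂ H] [CompleteSpace H]
    (T : H →L[ℂ] H) : star (absOp T) = absOp T ∧ absOp T * absOp T = star T * T ∧
      ∃ Q : H →L[ℂ] H, star Q = Q ∧ Q * Q = absOp T :=
  ⟨(CFC.abs_nonneg T).isSelfAdjoint, CFC.abs_mul_abs T, CFC.sqrt (CFC.abs T),
    (CFC.sqrt_nonneg _).isSelfAdjoint, CFC.sqrt_mul_sqrt_self _ (CFC.abs_nonneg T)⟩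

theorem norm_absOp_apply (T : Op ι) (x : Hilb ι) : ‖absOp T x‖ = ‖T x‖ := by
  obtain ⟨hsa, hsq, -⟩ := absOp_facts T
  have h : ∀ A : Op ι, (inner ℂ x ((star A * A) x)) = ((‖A x‖ : ℂ)) ^ 2 := fun A => by
    rw [mul_apply_eq_comp, ContinuousLinearMap.star_eq_adjoint,
      ContinuousLinearMap.adjoint_inner_right, inner_self_eq_norm_sq_to_K]
    rfl
  have h1 := h (absOp T)
  rw [hsa, hsq, h T] at h1
  have h2 : ‖T x‖ ^ 2 = ‖absOp T x‖ ^ 2 := by exact_mod_cast h1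
  exact ((sq_eq_sq₀ (norm_nonneg _) (norm_nonneg _)).1 h2).symm

theorem IsTraceClass.exists_decomp {T : Op ι} (hT : IsTraceClass T) :
    ∃ x y : ι → Hilb ι, IsDecomp T x y := by
  obtain ⟨W, hW⟩ := exists_factor T (absOp T) (fun x => (norm_absOp_apply T x).ge)
  obtain ⟨-, -, Q, hsa, hQQ⟩ := absOp_facts T
  have hadj : ∀ u v, inner ℂ (Q u) v = inner ℂ u (Q v) := fun u v => by
    conv_rhs => rw [← hsa]
    rw [ContinuousLinearMap.star_eq_adjoint, ContinuousLinearMap.adjoint_inner_right]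
  have hy : Summable fun i => ‖Q (ket i)‖ ^ 2 := by
    refine hT.congr fun i => ?_
    rw [elem, ← hQQ, mul_apply_eq_comp, ← hadj, inner_self_eq_norm_sq_to_K]
    norm_cast
  refine ⟨fun i => W (Q (ket i)), fun i => Q (ket i), ?_, hy, fun u v => ?_⟩
  · refine Summable.of_nonneg_of_le (fun i => by positivity) (fun i => ?_)
      (hy.mul_left (‖W‖ ^ 2))
    rw [← mul_pow]
    gcongr
    exact W.le_opNorm _
  · have h := lp.hasSum_inner (𝕜 := ℂ) (star (W * Q) u) (Q v)
    have h2 : inner ℂ (star (W * Q) u) (Q v) = inner ℂ u (T v) := by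
      rw [ContinuousLinearMap.star_eq_adjoint, ContinuousLinearMap.adjoint_inner_left, ← hW,
        ← hQQ]
      rfl
    rw [h2] at h
    refine hasSum_of_eq h fun i => ?_
    have h3 : inner ℂ u (W (Q (ket i))) = star ((star (W * Q) u) i) := by
      rw [← inner_ket_right, ContinuousLinearMap.star_eq_adjoint,
        ContinuousLinearMap.adjoint_inner_left]
      rfl
    rw [h3, hadj, inner_ket]
    exact mul_comm _ _

theorem summable_half {M : Type*} {a b : M → ℝ} (ha : Summable fun m => a m ^ 2)
    (hb : Summable fun m => b m ^ 2) (f : M → ℂ) (hf : ∀ m, ‖f m‖ ≤ |a m| * |b m|) :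
    Summable f := by
  refine Summable.of_norm_bounded (ha.add hb) fun m => (hf m).trans ?_
  nlinarith [sq_nonneg (|a m| - |b m|), sq_abs (a m), sq_abs (b m), sq_nonneg (a m),
    sq_nonneg (b m)]

/-- Square-summable families of vectors have jointly square-summable coordinates. -/
theorem summable_coord {M : Type*} {x : M → Hilb ι} (hx : Summable fun m => ‖x m‖ ^ 2) :
    Summable fun p : M × ι => ‖x p.1 p.2‖ ^ 2 := by
  rw [summable_prod_of_nonneg (fun p => by positivity)]
  exact ⟨fun m => (hasSum_norm_sq (x m)).summable,
    hx.congr fun m => ((hasSum_norm_sq (x m)).tsum_eq).symm⟩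

theorem IsDecomp.isTraceClass {M : Type*} {T : Op ι} {x y : M → Hilb ι} (h : IsDecomp T x y) :
    IsTraceClass T := by
  obtain ⟨V, hV⟩ := exists_factor (absOp T) T (fun x => (norm_absOp_apply T x).le)
  obtain ⟨hx, hy, hT⟩ := h
  have hx' : Summable fun m => ‖V (x m)‖ ^ 2 := by
    refine Summable.of_nonneg_of_le (fun i => by positivity) (fun i => ?_)
      (hx.mul_left (‖V‖ ^ 2))
    rw [← mul_pow]
    gcongr
    exact V.le_opNorm _
  have key : Summable fun p : ι × M => (V (x p.2)) p.1 * star (y p.2 p.1) := by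
    have h := summable_half (summable_coord hx') (summable_coord hy)
      (fun p => (V (x p.1)) p.2 * star (y p.1 p.2)) (fun p => by simp)
    exact h.comp_injective (i := Prod.swap) Prod.swap_injective
  have h1 : ∀ i, HasSum (fun m => (V (x m)) i * star (y m i)) (elem (absOp T) i i) := fun i => by
    have h2 := hT (star V (ket i)) (ket i)
    rw [ContinuousLinearMap.star_eq_adjoint, ContinuousLinearMap.adjoint_inner_left] at h2
    have h3 : elem (absOp T) i i = inner ℂ (ket i) (V (T (ket i))) := by
      rw [elem, ← hV]; rfl
    rw [h3]
    convert h2 using 2 with m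
    rw [ContinuousLinearMap.adjoint_inner_left, inner_ket, inner_ket_right]
  have h4 : Summable fun i => elem (absOp T) i i :=
    (key.hasSum.prod_fiberwise h1).summable
  exact (Complex.hasSum_re h4.hasSum).summable

theorem IsTraceClass.conj {T : Op ι} (hT : IsTraceClass T) (U : Op ι) :
    IsTraceClass (U * T * star U) := by
  obtain ⟨x, y, hx, hy, h⟩ := hT.exists_decomp
  have hb : ∀ z : ι → Hilb ι, (Summable fun m => ‖z m‖ ^ 2) →
      Summable fun m => ‖U (z m)‖ ^ 2 := fun z hz => by
    refine Summable.of_nonneg_of_le (fun i => by positivity) (fun i => ?_)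
      (hz.mul_left (‖U‖ ^ 2))
    rw [← mul_pow]
    gcongr
    exact U.le_opNorm _
  refine IsDecomp.isTraceClass (x := fun m => U (x m)) (y := fun m => U (y m))
    ⟨hb x hx, hb y hy, fun u v => ?_⟩
  have h1 := h (star U u) (star U v)
  simp only [ContinuousLinearMap.star_eq_adjoint, ContinuousLinearMap.adjoint_inner_left,
    ContinuousLinearMap.adjoint_inner_right] at h1
  exact h1

theorem exists_of_summable {M : Type*} {x y : M → Hilb ι} (hx : Summable fun m => ‖x m‖ ^ 2)
    (hy : Summable fun m => ‖y m‖ ^ 2) : ∃ T : Op ι, IsDecomp T x y := by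
  have hs : Summable fun m => InnerProductSpace.rankOne ℂ (x m) (y m) := by
    refine Summable.of_norm_bounded (hx.add hy) fun m => ?_
    rw [InnerProductSpace.norm_rankOne]
    nlinarith [sq_nonneg (‖x m‖ - ‖y m‖), sq_nonneg ‖x m‖, sq_nonneg ‖y m‖]
  refine ⟨∑' m, InnerProductSpace.rankOne ℂ (x m) (y m), hx, hy, fun u v => ?_⟩
  have h1 := hs.hasSum.mapL (ContinuousLinearMap.apply ℂ (Hilb ι) v)
  have h2 := h1.mapL (innerSL ℂ u)
  refine hasSum_of_eq h2 fun m => ?_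
  simp [mul_comm]

end Aux

/-! ### Partial trace -/

section PartialTrace

variable {K S : Type*}

theorem Restriction.split_injective (χ : Restriction K S) :
    Function.Injective fun G : Graph K S => (χ.res G, χ.compl G) := by
  intro G H h
  obtain ⟨h1, h2⟩ := Prod.mk.inj h
  have h3 : ∀ G : Graph K S, G.systems = (χ.res G).systems ∪ (χ.compl G).systems := fun G =>
    (Set.union_sdiff_cancel (χ.res_subset G)).symm
  ext1
  rw [h3 G, h3 H, h1, h2]

/-- The vector whose coordinate at `X` is the coordinate of `x` at the graph `G` with `G_χ = X`
and complement `L`, if there is one, and zero otherwise. -/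
theorem exists_slice (χ : Restriction K S) {M : Type*} (x : M → Hilb (Graph K S))
    (hx : Summable fun m => ‖x m‖ ^ 2) :
    ∃ z : M × Graph K S → Hilb (Graph K S), (Summable fun q => ‖z q‖ ^ 2) ∧
      (∀ m G, z (m, χ.compl G) (χ.res G) = x m G) ∧
      ∀ m X L, (∀ G, χ.res G = X → χ.compl G ≠ L) → z (m, L) X = 0 := by
  let φ : M × Graph K S → (M × Graph K S) × Graph K S :=
    fun p => ((p.1, χ.compl p.2), χ.res p.2)
  have hφ : Function.Injective φ := by
    rintro ⟨m, G⟩ ⟨m', G'⟩ h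
    simp only [φ, Prod.mk.injEq] at h
    exact Prod.ext h.1.1 (χ.split_injective (Prod.ext h.2 h.1.2))
  let f : (M × Graph K S) × Graph K S → ℂ := Function.extend φ (fun p => x p.1 p.2) 0
  have hf : ∀ p, f (φ p) = x p.1 p.2 := fun p => hφ.extend_apply _ _ p
  have hf0 : ∀ q, q ∉ Set.range φ → f q = 0 := fun q hq => by
    simp only [f]
    rw [Function.extend_apply' _ _ _ (by simpa using hq)]
    rfl
  have hs : Summable fun q => ‖f q‖ ^ 2 := by
    rw [← hφ.summable_iff (fun q hq => by simp [hf0 q hq])]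
    exact (summable_coord hx).congr fun p => by simp [hf]
  rw [summable_prod_of_nonneg (fun p => by positivity)] at hs
  have hm : ∀ q, Memℓp (fun X => f (q, X)) 2 := fun q =>
    memℓp_gen (by simpa using hs.1 q)
  refine ⟨fun q => ⟨fun X => f (q, X), hm q⟩, ?_, fun m G => hf (m, G), fun m X L h => ?_⟩
  · refine hs.2.congr fun q => ?_
    exact (hasSum_norm_sq (⟨fun X => f (q, X), hm q⟩ : Hilb (Graph K S))).tsum_eq
  · refine hf0 _ ?_
    rintro ⟨⟨m', G⟩, hG⟩
    simp only [φ, Prod.mk.injEq] at hG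
    exact h G hG.2 hG.1.2

/-- The linear extension of `|G⟩⟨H| ↦ |G_χ⟩⟨H_χ| ⟨H_χ̄|G_χ̄⟩` to a trace class operator
`ρ = ∑ ρ_GH |G⟩⟨H|` makes sense: the sums that give its matrix elements converge absolutely and are
the matrix elements of a trace class operator. -/
theorem exists_partialTrace (χ : Restriction K S) (ρ : TraceClass (Graph K S)) :
    ∃ τ : TraceClass (Graph K S), ∀ X Y : Graph K S,
      HasSum (fun p : Graph K S × Graph K S => elem ρ.1 p.1 p.2 *
          (braket X (χ.res p.1) * braket (χ.res p.2) Y * braket (χ.compl p.2) (χ.compl p.1)))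
        (elem τ.1 X Y) := by
  classical
  obtain ⟨x, y, hx, hy, hρ⟩ := ρ.2.exists_decomp
  obtain ⟨z, hz, hz1, hz0⟩ := exists_slice χ x hx
  obtain ⟨w, hw, hw1, hw0⟩ := exists_slice χ y hy
  obtain ⟨T, hT⟩ := exists_of_summable hz hw
  refine ⟨⟨T, hT.isTraceClass⟩, fun X Y => ?_⟩
  have h1 := hT.2.2 (ket X) (ket Y)
  simp only [inner_ket, inner_ket_right] at h1
  let P : Set (Graph K S × Graph K S) :=
    {p | χ.res p.1 = X ∧ χ.res p.2 = Y ∧ χ.compl p.1 = χ.compl p.2}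
  let ψ : P × Graph K S → Graph K S × Graph K S := fun p => (p.2, χ.compl p.1.1.1)
  have hψ : Function.Injective ψ := by
    rintro ⟨⟨⟨G, H⟩, h⟩, m⟩ ⟨⟨⟨G', H'⟩, h'⟩, m'⟩ hh
    simp only [ψ, Prod.mk.injEq] at hh
    obtain ⟨a1, a2, a3⟩ := h
    obtain ⟨b1, b2, b3⟩ := h'
    dsimp only at a1 a2 a3 b1 b2 b3
    have e1 : G = G' := χ.split_injective (Prod.ext (a1.trans b1.symm) hh.2)
    have e2 : H = H' := χ.split_injective (Prod.ext (a2.trans b2.symm)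
      (a3.symm.trans (hh.2.trans b3)))
    subst e1 e2
    simp [hh.1]
  rw [← hψ.hasSum_iff] at h1
  swap
  · rintro ⟨m, L⟩ hL
    by_cases hX : ∃ G, χ.res G = X ∧ χ.compl G = L
    · by_cases hY : ∃ H, χ.res H = Y ∧ χ.compl H = L
      · obtain ⟨G, hG, hG'⟩ := hX
        obtain ⟨H, hH, hH'⟩ := hY
        exact absurd ⟨(⟨(G, H), hG, hH, hG'.trans hH'.symm⟩, m), by simp [ψ, hG']⟩ hL
      · push Not at hY
        simp [hw0 m Y L hY]
    · push Not at hX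
      simp [hz0 m X L hX]
  have h2 : ∀ p : P, HasSum (fun m => z (ψ (p, m)) X * star (w (ψ (p, m)) Y))
      (elem ρ.1 p.1.1 p.1.2) := by
    rintro ⟨⟨G, H⟩, hG, hH, hGH⟩
    dsimp only at hG hH hGH
    have h3 := hρ (ket G) (ket H)
    simp only [inner_ket, inner_ket_right] at h3
    rw [elem, inner_ket]
    convert h3 using 2 with m
    simp only [ψ]
    rw [← hG, hz1, ← hH, hGH, hw1]
  have h4 : HasSum (fun p : P => elem ρ.1 p.1.1 p.1.2) (elem T X Y) := by
    rw [elem, inner_ket]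
    exact h1.prod_fiberwise h2
  have h5 := (hasSum_subtype_iff_indicator (s := P)
    (f := fun p : Graph K S × Graph K S => elem ρ.1 p.1 p.2)).1 h4
  refine hasSum_of_eq h5 fun p => ?_
  rw [Set.indicator_apply]
  simp only [braket_eq, P, Set.mem_ofPred_eq]
  by_cases c1 : χ.res p.1 = X <;> by_cases c2 : χ.res p.2 = Y <;>
    by_cases c3 : χ.compl p.1 = χ.compl p.2 <;>
    simp [c1, c2, c3, eq_comm (a := X), eq_comm (a := χ.compl p.2)]

/-- The partial trace `ρ ↦ ρ_{|χ}`; see `partialTrace_hasSum` for its matrix elements. -/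
def partialTrace (χ : Restriction K S) (ρ : TraceClass (Graph K S)) : TraceClass (Graph K S) :=
  Classical.choose (exists_partialTrace χ ρ)

/-- `⟨X|ρ_{|χ}|Y⟩ = ∑_{G,H} ρ_GH ⟨X|G_χ⟩⟨H_χ|Y⟩⟨H_χ̄|G_χ̄⟩`. -/
theorem partialTrace_hasSum (χ : Restriction K S) (ρ : TraceClass (Graph K S)) (X Y : Graph K S) :
    HasSum (fun p : Graph K S × Graph K S => elem ρ.1 p.1 p.2 *
        (braket X (χ.res p.1) * braket (χ.res p.2) Y * braket (χ.compl p.2) (χ.compl p.1)))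
      (elem (partialTrace χ ρ).1 X Y) :=
  Classical.choose_spec (exists_partialTrace χ ρ) X Y

end PartialTrace

/-! ### Causality -/

/-- The trace class operator `U ρ U†`. -/
def conj {ι : Type*} (U : Op ι) (ρ : TraceClass ι) : TraceClass ι :=
  ⟨U * ρ.1 * star U, ρ.2.conj U⟩

/-- `χζ`-causality: `(U ρ U†)_{|ζ} = (U ρ_{|χ} U†)_{|ζ}` for every trace class `ρ`. -/
def IsCausal {K S : Type*} (χ ζ : Restriction K S) (U : Op (Graph K S)) : Prop :=
  ∀ ρ : TraceClass (Graph K S),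
    partialTrace ζ (conj U ρ) = partialTrace ζ (conj U (partialTrace χ ρ))

/-- Name-preserving `χζ`-causality. -/
def IsNPCausal {K S : Type*} (χ ζ : Restriction K S) (U : Op (Graph K S)) : Prop :=
  IsNamePreserving U ∧ ∀ ρ : TraceClass (Graph K S), IsNamePreserving ρ.1 →
    partialTrace ζ (conj U ρ) = partialTrace ζ (conj U (partialTrace χ ρ))

end QNet

end

noncomputable section

namespace QNet

/-! ### Names -/

section Names

variable {C : Type*}

/-! Locality of observables is dual to the partial trace of states under the pairing `tr (A ρ)`. On
one side, a `χ`-local `A` satisfies `tr (A ρ_{|χ}) = tr (A ρ)`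
(`IsLocal.tracePairing_partialTrace`): splitting graphs as `G ↦ (G_χ, G_χ̄)`, such an `A` acts as `A
⊗ 1`. On the other side, each matrix element of `ρ_{|χ}` is `tr (D ρ)` for a `χ`-local `D`
(`isLocal_dualOp`, `tracePairing_dualOp`), so local observables determine the partial trace.

Since `tr (A U ρ U†) = tr (U† A U ρ)`, causality says that `U† A U` does not distinguish `ρ` from
`ρ_{|χ}` for any `ζ`-local `A`. Testing this on `ρ = |G⟩⟨H|` is exactly `χ`-locality of `U† A U`.

In the name-preserving case the same argument needs the test states and test observables to be
name-preserving. The key point is `sameNames_iff_of_compl_eq`: a common complement can be added or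
removed without affecting `≙`. The remaining matrix elements vanish on both sides.

For the strict versions, conjugation by a unitary is multiplicative, so the first two parts apply to
`A† A` and `A A†` as well. -/

theorem NameAlg.dot_nil (u : NameAlg C) : u.dot [] = u :=
  Quotient.inductionOn u fun u => Quotient.sound (NameTerm.Equiv.dot_nil u)

theorem NameAlg.dot_dot (u : NameAlg C) (s t : List Letter) :
    (u.dot s).dot t = u.dot (s ++ t) :=
  Quotient.inductionOn u fun u => Quotient.sound (NameTerm.Equiv.dot_dot u s t)

theorem NameAlg.join_dot_l (u v : NameAlg C) (t : List Letter) :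
    (u.join v).dot (Letter.l :: t) = u.dot t := by
  have h : (u.join v).dot [Letter.l] = u :=
    Quotient.inductionOn₂ u v fun u v => Quotient.sound (NameTerm.Equiv.join_l u v)
  rw [← List.singleton_append, ← NameAlg.dot_dot, h]

theorem NameAlg.join_dot_r (u v : NameAlg C) (t : List Letter) :
    (u.join v).dot (Letter.r :: t) = v.dot t := by
  have h : (u.join v).dot [Letter.r] = v :=
    Quotient.inductionOn₂ u v fun u v => Quotient.sound (NameTerm.Equiv.join_r u v)
  rw [← List.singleton_append, ← NameAlg.dot_dot, h]

theorem Generated.of_forall {V W : Set (NameAlg C)} (h : ∀ v ∈ V, Generated W v) {u : NameAlg C}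
    (hu : Generated V u) : Generated W u := by
  induction hu with
  | mem hv => exact h _ hv
  | dot t _ ih => exact ih.dot t
  | join _ _ ih₁ ih₂ => exact ih₁.join ih₂

theorem sameNames_iff {V W : Set (NameAlg C)} :
    SameNames V W ↔ (∀ v ∈ V, Generated W v) ∧ ∀ w ∈ W, Generated V w := by
  refine ⟨fun h => ⟨fun v hv => ?_, fun w hw => ?_⟩, fun h => ?_⟩
  · exact (Set.ext_iff.1 h v).1 (Generated.mem hv)
  · exact (Set.ext_iff.1 h w).2 (Generated.mem hw)
  · exact Set.ext fun u => ⟨Generated.of_forall h.1, Generated.of_forall h.2⟩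

theorem SameNames.union_right {V W : Set (NameAlg C)} (h : SameNames V W) (Z : Set (NameAlg C)) :
    SameNames (V ∪ Z) (W ∪ Z) := by
  rw [sameNames_iff] at h ⊢
  have key : ∀ {V W : Set (NameAlg C)}, (∀ v ∈ V, Generated W v) →
      ∀ v ∈ V ∪ Z, Generated (W ∪ Z) v := by
    rintro V W h v (hv | hv)
    · exact (h v hv).of_forall fun w hw => .mem (.inl hw)
    · exact .mem (.inr hv)
  exact ⟨key h.1, key h.2⟩

/-- A name built from `V ∪ Z` none of whose descendants is a descendant of a name in `Z` is built
from `V`. -/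
theorem Generated.of_union {V Z : Set (NameAlg C)} {u : NameAlg C} (hu : Generated (V ∪ Z) u)
    (h : ∀ t, ∀ z ∈ Z, ∀ s, u.dot t ≠ z.dot s) : Generated V u := by
  -- The claim is strengthened to all descendants `u.r`, so that the induction passes through `dot`;
  -- at a join, the first letter of `r` selects the component.
  suffices key : ∀ r, (∀ t, ∀ z ∈ Z, ∀ s, (u.dot r).dot t ≠ z.dot s) → Generated V (u.dot r) by
    simpa only [NameAlg.dot_nil] using key [] (by simpa only [NameAlg.dot_nil] using h)
  clear h
  induction hu with
  | @mem v hv =>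
    intro r hr
    rcases hv with hv | hv
    · exact .dot r (.mem hv)
    -- A descendant of a name in `Z` violates the hypothesis with `t = ε`.
    · exact absurd (NameAlg.dot_nil _) (hr [] v hv r)
  | dot t _ ih =>
    intro r hr
    rw [NameAlg.dot_dot] at hr ⊢
    exact ih _ hr
  | @join v w _ _ ih₁ ih₂ =>
    rintro (_ | ⟨_ | _, r⟩) hr
    · rw [NameAlg.dot_nil] at hr ⊢
      have h₁ := ih₁ [] fun t z hz s => by
        rw [NameAlg.dot_nil, ← NameAlg.join_dot_l v w]; exact hr _ z hz s
      have h₂ := ih₂ [] fun t z hz s => by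
        rw [NameAlg.dot_nil, ← NameAlg.join_dot_r v w]; exact hr _ z hz s
      rw [NameAlg.dot_nil] at h₁ h₂
      exact h₁.join h₂
    · rw [NameAlg.join_dot_l] at hr ⊢
      exact ih₁ r hr
    · rw [NameAlg.join_dot_r] at hr ⊢
      exact ih₂ r hr

end Names

/-! ### Restrictions -/

section Restrictions

variable {K S : Type*} (χ : Restriction K S)

theorem Restriction.support_eq (G : Graph K S) :
    G.support = (χ.res G).support ∪ (χ.compl G).support := by
  rw [Graph.support, Graph.support, Graph.support, ← Set.image_union]
  exact congrArg _ (Set.union_sdiff_cancel (χ.res_subset G)).symm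

theorem Restriction.res_res (G : Graph K S) : χ.res (χ.res G) = χ.res G :=
  χ.res_eq G (χ.res G) subset_rfl (χ.res_subset G)

theorem Restriction.compl_res_systems (G : Graph K S) : (χ.compl (χ.res G)).systems = ∅ := by
  change (χ.res G).systems \ (χ.res (χ.res G)).systems = ∅
  rw [χ.res_res, Set.sdiff_self]

theorem Restriction.compl_res_eq (G H : Graph K S) : χ.compl (χ.res G) = χ.compl (χ.res H) :=
  Graph.ext (by rw [compl_res_systems, compl_res_systems])

/-- Adding the common complement to both supports is harmless. It can also be removed: by
well-namedness no descendant of a name in `G_χ` is a descendant of a name in the complement, so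
`Generated.of_union` discards the complement. -/
theorem Restriction.sameNames_iff_of_compl_eq {G H : Graph K S} (h : χ.compl G = χ.compl H) :
    SameNames G.support H.support ↔ SameNames (χ.res G).support (χ.res H).support := by
  refine ⟨fun hGH => ?_, fun hGH => ?_⟩
  · have key : ∀ {G H : Graph K S}, χ.compl G = χ.compl H →
        (∀ v ∈ G.support, Generated H.support v) →
        ∀ v ∈ (χ.res G).support, Generated (χ.res H).support v := by
      rintro G H h hGH _ ⟨a, ha, rfl⟩
      have hG : Generated H.support a.2 := hGH _ ⟨a, χ.res_subset G ha, rfl⟩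
      rw [χ.support_eq H, ← h] at hG
      refine hG.of_union ?_
      rintro t _ ⟨b, hb, rfl⟩ s hts
      obtain ⟨h₁, h₂, -⟩ := G.wellNamed a (χ.res_subset G ha) b hb.1 t s hts
      exact hb.2 ((Prod.ext h₁ h₂ : a = b) ▸ ha)
    rw [sameNames_iff] at hGH ⊢
    exact ⟨key h hGH.1, key h.symm hGH.2⟩
  · rw [χ.support_eq G, χ.support_eq H, ← h]
    exact hGH.union_right _

end Restrictions

/-! ### Matrix elements and traces -/

section Trace

variable {ι : Type*}

theorem elem_eq (A : Op ι) (i j : ι) : elem A i j = A (ket j) i := inner_ket _ _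

open Classical in
theorem ket_apply (i j : ι) : (ket i : Hilb ι) j = if j = i then 1 else 0 := by
  rw [← inner_ket, ← braket, braket_eq]

theorem elem_star (A : Op ι) (i j : ι) : elem (star A) i j = star (elem A j i) := by
  rw [elem, ContinuousLinearMap.star_eq_adjoint, ContinuousLinearMap.adjoint_inner_right,
    elem_eq, inner_ket_right]

theorem hasSum_inner_coord (x y : Hilb ι) : HasSum (fun i => x i * star (y i)) (inner ℂ y x) :=
  hasSum_of_eq (lp.hasSum_inner (𝕜 := ℂ) y x) fun _ => rfl

/-- This is the coordinate expansion of the inner product of `A† |i⟩` with `x`. -/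
theorem hasSum_elem_mul (A : Op ι) (x : Hilb ι) (i : ι) :
    HasSum (fun j => elem A i j * x j) (A x i) := by
  have h := hasSum_inner_coord x (star A (ket i))
  rw [ContinuousLinearMap.star_eq_adjoint, ContinuousLinearMap.adjoint_inner_left, inner_ket] at h
  refine hasSum_of_eq h fun j => ?_
  rw [← ContinuousLinearMap.star_eq_adjoint, ← elem_eq, elem_star, star_star, mul_comm]

theorem hasSum_elem_comp (A B : Op ι) (i k : ι) :
    HasSum (fun j => elem A i j * elem B j k) (elem (A * B) i k) := by
  rw [elem_eq (A * B)]
  exact hasSum_of_eq (hasSum_elem_mul A (B (ket k)) i) fun j => by rw [elem_eq B]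

theorem op_ext {A B : Op ι} (h : ∀ i j, elem A i j = elem B i j) : A = B := by
  have hk : ∀ i x, A x i = B x i := fun i x =>
    (hasSum_elem_mul A x i).unique (hasSum_of_eq (hasSum_elem_mul B x i) fun j => by rw [h])
  ext x i
  exact hk i x

/-- The trace of `A T`. -/
def tracePairing (A T : Op ι) : ℂ := ∑' i, elem (A * T) i i

theorem summable_norm_sq_map {M : Type*} (A : Op ι) {x : M → Hilb ι}
    (hx : Summable fun m => ‖x m‖ ^ 2) : Summable fun m => ‖A (x m)‖ ^ 2 := by
  refine Summable.of_nonneg_of_le (fun i => by positivity) (fun i => ?_) (hx.mul_left (‖A‖ ^ 2))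
  rw [← mul_pow]
  gcongr
  exact A.le_opNorm _

/-- The family indexed by `M × ι` is absolutely summable, both factors being square-summable.
Summing over `ι` first gives the left side, summing over `M` first the diagonal of `A T`. Hence the
trace converges and may be computed from any decomposition. -/
theorem IsDecomp.hasSum_tracePairing {M : Type*} {T : Op ι} {x y : M → Hilb ι}
    (h : IsDecomp T x y) (A : Op ι) :
    HasSum (fun m => inner ℂ (y m) (A (x m))) (tracePairing A T) := by
  obtain ⟨hx, hy, hT⟩ := h
  have hs : Summable fun p : M × ι => A (x p.1) p.2 * star (y p.1 p.2) :=
    summable_half (summable_coord (summable_norm_sq_map A hx)) (summable_coord hy) _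
      (fun p => by simp)
  have h₁ := hs.hasSum.prod_fiberwise fun m => hasSum_inner_coord (A (x m)) (y m)
  have h₂ := ((Equiv.prodComm ι M).hasSum_iff.2 hs.hasSum).prod_fiberwise (g := fun i =>
    elem (A * T) i i) fun i => by
    have h := hT (star A (ket i)) (ket i)
    rw [ContinuousLinearMap.star_eq_adjoint, ContinuousLinearMap.adjoint_inner_left] at h
    refine hasSum_of_eq h fun m => ?_
    rw [ContinuousLinearMap.adjoint_inner_left, inner_ket, inner_ket_right]
    rfl
  rw [tracePairing, h₂.tsum_eq]
  exact h₁

theorem IsDecomp.conj {M : Type*} {T : Op ι} {x y : M → Hilb ι} (h : IsDecomp T x y) (U : Op ι) :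
    IsDecomp (U * T * star U) (fun m => U (x m)) (fun m => U (y m)) := by
  refine ⟨summable_norm_sq_map U h.1, summable_norm_sq_map U h.2.1, fun u v => ?_⟩
  have h₁ := h.2.2 (star U u) (star U v)
  simp only [ContinuousLinearMap.star_eq_adjoint, ContinuousLinearMap.adjoint_inner_left,
    ContinuousLinearMap.adjoint_inner_right] at h₁
  exact h₁

/-- Cyclicity of the trace: `U` carries a decomposition of `ρ` to one of `U ρ U†`, and the two sums
agree term by term. -/
theorem tracePairing_conj (A U : Op ι) (ρ : TraceClass ι) :
    tracePairing A (conj U ρ).1 = tracePairing (star U * A * U) ρ.1 := by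
  obtain ⟨x, y, h⟩ := ρ.2.exists_decomp
  refine ((h.conj U).hasSum_tracePairing A).unique
    (hasSum_of_eq (h.hasSum_tracePairing (star U * A * U)) fun m => ?_)
  rw [ContinuousLinearMap.star_eq_adjoint]
  exact (ContinuousLinearMap.adjoint_inner_right U (y m) (A (U (x m)))).symm

theorem isDecomp_rankOne (x y : Hilb ι) :
    IsDecomp (InnerProductSpace.rankOne ℂ x y) (fun _ : Unit => x) (fun _ => y) := by
  refine ⟨(hasSum_fintype _).summable, (hasSum_fintype _).summable, fun u v => ?_⟩
  convert hasSum_unique (fun _ : Unit => inner ℂ u x * inner ℂ y v) using 1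
  simp [mul_comm]

theorem tracePairing_rankOne (A : Op ι) (x y : Hilb ι) :
    tracePairing A (InnerProductSpace.rankOne ℂ x y) = inner ℂ y (A x) :=
  ((isDecomp_rankOne x y).hasSum_tracePairing A).unique (hasSum_unique _)

theorem elem_rankOne (x y : Hilb ι) (i j : ι) :
    elem (InnerProductSpace.rankOne ℂ x y) i j = x i * star (y j) := by
  rw [elem, ← inner_ket_right, ← inner_ket]
  simp [mul_comm]

theorem orthonormal_ket : Orthonormal ℂ (ket : ι → Hilb ι) := by
  classical
  exact orthonormal_iff_ite.2 fun i j => braket_eq i j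

/-- The isometry `ℓ²(P) → ℓ²(ι)` that extends an injection `P → ι` of the basis labels. -/
def embed {P : Type*} {φ : P → ι} (hφ : φ.Injective) : Hilb P →L[ℂ] Hilb ι :=
  (orthonormal_ket.comp φ hφ).orthogonalFamily.linearIsometry.toContinuousLinearMap

theorem embed_ket {P : Type*} {φ : P → ι} (hφ : φ.Injective) (p : P) :
    embed hφ (ket p) = ket (φ p) := by
  classical
  refine ((orthonormal_ket.comp φ hφ).orthogonalFamily.linearIsometry_apply_single (1 : ℂ)).trans ?_
  simp

theorem adjoint_embed_apply {P : Type*} {φ : P → ι} (hφ : φ.Injective) (x : Hilb ι) (p : P) :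
    ContinuousLinearMap.adjoint (embed hφ) x p = x (φ p) := by
  rw [← inner_ket, ContinuousLinearMap.adjoint_inner_right, embed_ket, inner_ket]

end Trace

/-! ### Locality and the partial trace -/

section Local

variable {K S : Type*} (χ : Restriction K S)

/-- The pairs of graphs with restrictions `X` and `Y` and equal complements. -/
abbrev Restriction.Pair (X Y : Graph K S) : Type _ :=
  {p : Graph K S × Graph K S // χ.res p.1 = X ∧ χ.res p.2 = Y ∧ χ.compl p.1 = χ.compl p.2}

/-- One member fixes the shared complement, and the restriction of the other member is prescribed.
This makes `dualOp` a partial isometry between basis vectors. -/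
theorem Restriction.Pair.fst_injective (X Y : Graph K S) :
    Function.Injective fun p : χ.Pair X Y => p.1.1 := by
  rintro ⟨⟨G, H⟩, h₁, h₂, h₃⟩ ⟨⟨G', H'⟩, h₁', h₂', h₃'⟩ (h : G = G')
  subst h
  exact Subtype.ext (Prod.ext rfl
    (χ.split_injective (Prod.ext (h₂.trans h₂'.symm) (h₃.symm.trans h₃'))))

theorem Restriction.Pair.snd_injective (X Y : Graph K S) :
    Function.Injective fun p : χ.Pair X Y => p.1.2 := by
  rintro ⟨⟨G, H⟩, h₁, h₂, h₃⟩ ⟨⟨G', H'⟩, h₁', h₂', h₃'⟩ (h : H = H')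
  subst h
  exact Subtype.ext (Prod.ext
    (χ.split_injective (Prod.ext (h₁.trans h₁'.symm) (h₃.trans h₃'.symm))) rfl)

/-- The operator dual to `|Y⟩⟨X|` under the partial trace: it maps `|G⟩` with `G_χ = X` to `|H⟩`
with `H_χ = Y` and the same complement, and all other basis vectors to zero. -/
def Restriction.dualOp (X Y : Graph K S) : Op (Graph K S) :=
  embed (Pair.snd_injective χ X Y) ∘L
    ContinuousLinearMap.adjoint (embed (Pair.fst_injective χ X Y))

theorem Restriction.hasSum_inner_dualOp (X Y : Graph K S) (x y : Hilb (Graph K S)) :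
    HasSum (fun p : χ.Pair X Y => x p.1.1 * star (y p.1.2)) (inner ℂ y (χ.dualOp X Y x)) := by
  rw [dualOp, ContinuousLinearMap.comp_apply, ← ContinuousLinearMap.adjoint_inner_left]
  refine hasSum_of_eq (hasSum_inner_coord _ _) fun p => ?_
  rw [adjoint_embed_apply, adjoint_embed_apply]

open Classical in
theorem Restriction.elem_dualOp (X Y G H : Graph K S) : elem (χ.dualOp X Y) H G =
    if χ.res G = X ∧ χ.res H = Y ∧ χ.compl G = χ.compl H then 1 else 0 := by
  refine (χ.hasSum_inner_dualOp X Y (ket G) (ket H)).unique ?_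
  split_ifs with h
  · convert hasSum_single (⟨(G, H), h⟩ : χ.Pair X Y) fun p hp => ?_
    · simp [ket_apply]
    · by_cases hG : p.1.1 = G
      · exact absurd (Pair.fst_injective χ X Y hG) hp
      · simp [ket_apply, hG]
  · refine hasSum_of_eq hasSum_zero fun p => ?_
    by_cases hG : p.1.1 = G
    · by_cases hH : p.1.2 = H
      · exact absurd (hG ▸ hH ▸ p.2) h
      · simp [ket_apply, hH]
    · simp [ket_apply, hG]

/-- Restricted graphs have empty complement, so for them the condition of equal complements is
automatic; for general graphs it is supplied by the factor `braket`. -/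
theorem Restriction.isLocal_dualOp (X Y : Graph K S) : IsLocal χ (χ.dualOp X Y) := by
  classical
  intro G H
  rw [elem_dualOp, elem_dualOp, χ.res_res, χ.res_res, braket_eq, χ.compl_res_eq G H]
  by_cases h₁ : χ.res G = X <;> by_cases h₂ : χ.res H = Y <;>
    by_cases h₃ : χ.compl G = χ.compl H <;> simp [h₁, h₂, h₃, eq_comm (a := χ.compl H)]

theorem hasSum_elem_partialTrace (ρ : TraceClass (Graph K S)) (X Y : Graph K S) :
    HasSum (fun p : χ.Pair X Y => elem ρ.1 p.1.1 p.1.2) (elem (partialTrace χ ρ).1 X Y) := by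
  classical
  refine (hasSum_subtype_iff_indicator (f := fun p : Graph K S × Graph K S => elem ρ.1 p.1 p.2)
    (s := {p | χ.res p.1 = X ∧ χ.res p.2 = Y ∧ χ.compl p.1 = χ.compl p.2})).2 ?_
  refine hasSum_of_eq (partialTrace_hasSum χ ρ X Y) fun p => ?_
  rw [Set.indicator_apply]
  simp only [braket_eq, Set.mem_ofPred_eq]
  by_cases h₁ : χ.res p.1 = X <;> by_cases h₂ : χ.res p.2 = Y <;>
    by_cases h₃ : χ.compl p.1 = χ.compl p.2 <;>
    simp [h₁, h₂, h₃, eq_comm (a := X), eq_comm (a := χ.compl p.2)]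

/-- The diagonal element at `H` vanishes unless `H` is the second member of a pair `(G, H)`, and
then equals `⟨G|ρ|H⟩`. The trace is thus the sum over pairs that defines the partial trace. -/
theorem tracePairing_dualOp (ρ : TraceClass (Graph K S)) (X Y : Graph K S) :
    tracePairing (χ.dualOp X Y) ρ.1 = elem (partialTrace χ ρ).1 X Y := by
  classical
  have hd : ∀ H, HasSum (fun p : χ.Pair X Y => elem ρ.1 p.1.1 H * star (ket H p.1.2 : ℂ))
      (elem (χ.dualOp X Y * ρ.1) H H) := fun H =>
    hasSum_of_eq (χ.hasSum_inner_dualOp X Y (ρ.1 (ket H)) (ket H)) fun p => by rw [elem_eq]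
  refine HasSum.tsum_eq ?_
  refine ((Restriction.Pair.snd_injective χ X Y).hasSum_iff fun H hH => ?_).1
    (hasSum_of_eq (hasSum_elem_partialTrace χ ρ X Y) fun p => ?_)
  · refine (hd H).unique (hasSum_of_eq hasSum_zero fun p => ?_)
    have : p.1.2 ≠ H := fun h => hH ⟨p, h⟩
    simp [ket_apply, this]
  · refine (hd p.1.2).unique ?_
    convert hasSum_single p fun q hq => ?_
    · simp [ket_apply]
    · have : q.1.2 ≠ p.1.2 := fun h => hq (Restriction.Pair.snd_injective χ X Y h)
      simp [ket_apply, this]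

/-- `z L` is the part of `x` on the graphs with complement `L`, relabelled by `G ↦ G_χ`. -/
structure IsSlice (x : Hilb (Graph K S)) (z : Graph K S → Hilb (Graph K S)) : Prop where
  apply_res : ∀ G, z (χ.compl G) (χ.res G) = x G
  apply_eq_zero : ∀ X L, (∀ G, χ.res G = X → χ.compl G ≠ L) → z L X = 0

variable {χ}

/-- This is the form `B ⊗ 1` of a local operator: complements are not mixed, and the same `B` acts
on every slice. -/
theorem IsLocal.apply_eq {B : Op (Graph K S)} (hB : IsLocal χ B) {x : Hilb (Graph K S)}
    {z : Graph K S → Hilb (Graph K S)} (hz : IsSlice χ x z) (H : Graph K S) :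
    B x H = B (z (χ.compl H)) (χ.res H) := by
  classical
  let D : Set (Graph K S) := {G | χ.compl G = χ.compl H}
  have hD : Function.Injective fun G : D => χ.res G := fun G G' h =>
    Subtype.ext (χ.split_injective (Prod.ext h (G.2.trans G'.2.symm)))
  -- Not every pair `(X, L)` comes from a graph; the slice is zero at those that do not, which
  -- reduces the sum to graphs with the complement of `H`.
  have h₁ := (hD.hasSum_iff fun X hX => by
    rw [hz.apply_eq_zero X _ fun G hG hG' => hX ⟨⟨G, hG'⟩, hG⟩, mul_zero]).2
    (hasSum_elem_mul B (z (χ.compl H)) (χ.res H))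
  have h₂ : HasSum (fun G : D => elem B (χ.res H) (χ.res G) * x G)
      (B (z (χ.compl H)) (χ.res H)) := hasSum_of_eq h₁ fun G => by
    have hG : χ.compl G = χ.compl H := G.2
    rw [Function.comp_apply, ← hG, hz.apply_res]
  have h₃ := (hasSum_subtype_iff_indicator (s := D)
    (f := fun G => elem B (χ.res H) (χ.res G) * x G)).1 h₂
  refine (hasSum_elem_mul B x H).unique (hasSum_of_eq h₃ fun G => ?_)
  rw [Set.indicator_apply, hB, braket_eq]
  by_cases h : χ.compl G = χ.compl H <;> simp [D, h, eq_comm (a := χ.compl H)]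

theorem IsLocal.hasSum_inner {B : Op (Graph K S)} (hB : IsLocal χ B) {x y : Hilb (Graph K S)}
    {z w : Graph K S → Hilb (Graph K S)} (hz : IsSlice χ x z) (hw : IsSlice χ y w) :
    HasSum (fun L => inner ℂ (w L) (B (z L))) (inner ℂ y (B x)) := by
  have hφ : Function.Injective fun H : Graph K S => (χ.compl H, χ.res H) := fun G H h =>
    χ.split_injective (Prod.ext (Prod.mk.inj h).2 (Prod.mk.inj h).1)
  have h₁ : HasSum (fun p : Graph K S × Graph K S => B (z p.1) p.2 * star (w p.1 p.2))
      (inner ℂ y (B x)) := by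
    refine (hφ.hasSum_iff ?_).1 (hasSum_of_eq (hasSum_inner_coord (B x) y) fun H => ?_)
    -- At a pair that comes from no graph `B (z L)` need not vanish, but `w L` does.
    · rintro ⟨L, X⟩ hLX
      have : w L X = 0 := hw.apply_eq_zero X L fun G h h' => hLX ⟨G, Prod.ext h' h⟩
      simp [this]
    · rw [Function.comp_apply, hB.apply_eq hz, hw.apply_res H]
  exact h₁.prod_fiberwise fun L => hasSum_inner_coord (B (z L)) (w L)

/-- Tracing out the complement turns each `|x m⟩⟨y m|` into the sum over `L` of its slices. For
fixed `m`, the matrix elements of this sum are those of `⟨y m| D |x m⟩` with `D` the dual operator,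
so both sides are computed by `tracePairing_dualOp`. -/
theorem IsDecomp.partialTrace {M : Type*} {ρ : TraceClass (Graph K S)}
    {x y : M → Hilb (Graph K S)} (h : IsDecomp ρ.1 x y)
    {z w : M × Graph K S → Hilb (Graph K S)}
    (hz : ∀ m, IsSlice χ (x m) fun L => z (m, L)) (hw : ∀ m, IsSlice χ (y m) fun L => w (m, L))
    (hz' : Summable fun q => ‖z q‖ ^ 2) (hw' : Summable fun q => ‖w q‖ ^ 2) :
    IsDecomp (QNet.partialTrace χ ρ).1 z w := by
  obtain ⟨T, hT⟩ := exists_of_summable hz' hw'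
  suffices hTρ : T = (QNet.partialTrace χ ρ).1 from hTρ ▸ hT
  refine op_ext fun X Y => ?_
  have h₁ : HasSum (fun q => z q X * star (w q Y)) (elem T X Y) := by
    refine hasSum_of_eq (hT.2.2 (ket X) (ket Y)) fun q => ?_
    rw [inner_ket, inner_ket_right]
  rw [← tracePairing_dualOp]
  refine (h₁.prod_fiberwise fun m => ?_).unique (h.hasSum_tracePairing (χ.dualOp X Y))
  have hψ : Function.Injective fun p : χ.Pair X Y => χ.compl p.1.1 := fun p p' hp =>
    Restriction.Pair.fst_injective χ X Y
      (χ.split_injective (Prod.ext (p.2.1.trans p'.2.1.symm) hp))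
  refine (hψ.hasSum_iff fun L hL => ?_).1
    (hasSum_of_eq (χ.hasSum_inner_dualOp X Y (x m) (y m)) fun p => ?_)
  · by_cases hX : ∃ G, χ.res G = X ∧ χ.compl G = L
    · obtain ⟨G, hG, hG'⟩ := hX
      have : w (m, L) Y = 0 := (hw m).apply_eq_zero Y L fun H hH hH' =>
        hL ⟨⟨(G, H), hG, hH, hG'.trans hH'.symm⟩, hG'⟩
      simp [this]
    · push Not at hX
      have : z (m, L) X = 0 := (hz m).apply_eq_zero X L hX
      simp [this]
  · have h₂ : z (m, χ.compl p.1.1) X = x m p.1.1 := by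
      have := (hz m).apply_res p.1.1
      rwa [p.2.1] at this
    have h₃ : w (m, χ.compl p.1.1) Y = y m p.1.2 := by
      have := (hw m).apply_res p.1.2
      rwa [p.2.2.1, ← p.2.2.2] at this
    rw [Function.comp_apply, h₂, h₃]

/-- A `χ`-local observable only sees the partial trace. -/
theorem IsLocal.tracePairing_partialTrace {B : Op (Graph K S)} (hB : IsLocal χ B)
    (ρ : TraceClass (Graph K S)) :
    tracePairing B (partialTrace χ ρ).1 = tracePairing B ρ.1 := by
  obtain ⟨x, y, h⟩ := ρ.2.exists_decomp
  obtain ⟨z, hz, hz₁, hz₀⟩ := exists_slice χ x h.1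
  obtain ⟨w, hw, hw₁, hw₀⟩ := exists_slice χ y h.2.1
  have hsz : ∀ m, IsSlice χ (x m) fun L => z (m, L) := fun m => ⟨hz₁ m, hz₀ m⟩
  have hsw : ∀ m, IsSlice χ (y m) fun L => w (m, L) := fun m => ⟨hw₁ m, hw₀ m⟩
  have h₁ := (h.partialTrace hsz hsw hz hw).hasSum_tracePairing B
  exact (h₁.prod_fiberwise fun m => hB.hasSum_inner (hsz m) (hsw m)).unique (h.hasSum_tracePairing B)

/-- The trace class operator `|G⟩⟨H|`. -/
def ketBra {ι : Type*} (G H : ι) : TraceClass ι :=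
  ⟨InnerProductSpace.rankOne ℂ (ket G) (ket H), (isDecomp_rankOne _ _).isTraceClass⟩

theorem partialTrace_ketBra (G H : Graph K S) : (partialTrace χ (ketBra G H)).1 =
    InnerProductSpace.rankOne ℂ (braket (χ.compl H) (χ.compl G) • ket (χ.res G))
      (ket (χ.res H)) := by
  classical
  refine op_ext fun X Y => (partialTrace_hasSum χ (ketBra G H) X Y).unique ?_
  convert hasSum_single (G, H) ?_ using 1
  · rw [ketBra, elem_rankOne, elem_rankOne]
    simp only [lp.coeFn_smul, Pi.smul_apply, ket_apply, braket_eq, smul_eq_mul,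
      eq_comm (a := Y)]
    by_cases h₁ : X = χ.res G <;> by_cases h₂ : χ.res H = Y <;> simp [h₁, h₂]
  · rintro ⟨G', H'⟩ hne
    rw [ketBra, elem_rankOne, ket_apply, ket_apply]
    by_cases h₁ : G' = G <;> by_cases h₂ : H' = H <;> simp_all

/-- `χ`-locality at a pair of graphs, tested on `|G⟩⟨H|`. -/
theorem elem_eq_of_tracePairing {B : Op (Graph K S)} {G H : Graph K S}
    (h : tracePairing B (ketBra G H).1 = tracePairing B (partialTrace χ (ketBra G H)).1) :
    elem B H G = elem B (χ.res H) (χ.res G) * braket (χ.compl H) (χ.compl G) := by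
  rw [partialTrace_ketBra, tracePairing_rankOne, map_smul, inner_smul_right, ketBra,
    tracePairing_rankOne] at h
  rw [elem, h, mul_comm]
  rfl

end Local

/-! ### Name preservation -/

section NamePreserving

variable {K S : Type*}

theorem IsNamePreserving.mul {A B : Op (Graph K S)} (hA : IsNamePreserving A)
    (hB : IsNamePreserving B) : IsNamePreserving (A * B) := by
  intro G H hGH
  refine (hasSum_elem_comp A B H G).unique (hasSum_of_eq hasSum_zero fun L => ?_)
  by_cases h₁ : SameNames G.support L.support
  · by_cases h₂ : SameNames L.support H.support
    · exact absurd (h₁.trans h₂) hGH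
    · rw [hA _ _ h₂, zero_mul]
  · rw [hB _ _ h₁, mul_zero]

theorem IsNamePreserving.star {A : Op (Graph K S)} (hA : IsNamePreserving A) :
    IsNamePreserving (star A) := fun G H hGH => by
  rw [elem_star, hA H G fun h => hGH h.symm, star_zero]

/-- Only pairs with equal complements contribute, and for them the full graphs have the same names
exactly when their restrictions do. -/
theorem isNamePreserving_partialTrace (χ : Restriction K S) {ρ : TraceClass (Graph K S)}
    (hρ : IsNamePreserving ρ.1) : IsNamePreserving (partialTrace χ ρ).1 := by
  intro Y X h
  refine (hasSum_elem_partialTrace χ ρ X Y).unique (hasSum_of_eq hasSum_zero fun p => ?_)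
  obtain ⟨⟨G, H⟩, rfl, rfl, hp⟩ := p
  exact hρ H G fun hHG => h ((χ.sameNames_iff_of_compl_eq hp.symm).1 hHG)

theorem Restriction.isNamePreserving_dualOp (χ : Restriction K S) {X Y : Graph K S}
    (h : SameNames X.support Y.support) : IsNamePreserving (χ.dualOp X Y) := by
  classical
  intro G H hGH
  rw [elem_dualOp, if_neg]
  rintro ⟨rfl, rfl, h₃⟩
  exact hGH ((χ.sameNames_iff_of_compl_eq h₃).2 h)

theorem isNamePreserving_ketBra {G H : Graph K S} (h : SameNames G.support H.support) :
    IsNamePreserving (ketBra G H).1 := by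
  classical
  intro G' H' h'
  rw [ketBra, elem_rankOne, ket_apply, ket_apply]
  by_cases h₁ : H' = G
  · by_cases h₂ : G' = H
    · subst h₁ h₂
      exact absurd h.symm h'
    · simp [h₂]
  · simp [h₁]

end NamePreserving

/-! ### Causality -/

section Causality

variable {K S : Type*} {χ ζ : Restriction K S} {U : Op (Graph K S)}

/-- From states to observables: the `ζ`-local `A` sees only the partial traces, which agree. -/
theorem tracePairing_conj_eq_of_partialTrace_eq {ρ : TraceClass (Graph K S)}
    (h : partialTrace ζ (conj U ρ) = partialTrace ζ (conj U (partialTrace χ ρ)))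
    {A : Op (Graph K S)} (hA : IsLocal ζ A) :
    tracePairing (star U * A * U) ρ.1 =
      tracePairing (star U * A * U) (partialTrace χ ρ).1 := by
  rw [← tracePairing_conj, ← tracePairing_conj, ← hA.tracePairing_partialTrace, h,
    hA.tracePairing_partialTrace]

/-- From observables to states: the dual operator reads off one matrix element, and its conjugate is
`χ`-local. -/
theorem elem_partialTrace_conj_eq {X Y : Graph K S}
    (h : IsLocal χ (star U * ζ.dualOp X Y * U)) (ρ : TraceClass (Graph K S)) :
    elem (partialTrace ζ (conj U ρ)).1 X Y =
      elem (partialTrace ζ (conj U (partialTrace χ ρ))).1 X Y := by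
  rw [← tracePairing_dualOp, ← tracePairing_dualOp, tracePairing_conj, tracePairing_conj,
    h.tracePairing_partialTrace]

theorem isCausal_iff : IsCausal χ ζ U ↔
    ∀ A : Op (Graph K S), IsLocal ζ A → IsLocal χ (star U * A * U) :=
  ⟨fun h _ hA G H => elem_eq_of_tracePairing
      (tracePairing_conj_eq_of_partialTrace_eq (h (ketBra G H)) hA),
    fun h ρ => Subtype.ext (op_ext fun X Y =>
      elem_partialTrace_conj_eq (h _ (ζ.isLocal_dualOp X Y)) ρ)⟩

theorem isNPCausal_iff : IsNPCausal χ ζ U ↔ IsNamePreserving U ∧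
    ∀ A : Op (Graph K S), IsNamePreserving A ∧ IsLocal ζ A →
      IsNamePreserving (star U * A * U) ∧ IsLocal χ (star U * A * U) := by
  refine ⟨fun ⟨hU, h⟩ => ⟨hU, fun A ⟨hA, hA'⟩ => ?_⟩, fun ⟨hU, h⟩ => ⟨hU, fun ρ hρ => ?_⟩⟩
  · have hB : IsNamePreserving (star U * A * U) := (hU.star.mul hA).mul hU
    refine ⟨hB, fun G H => ?_⟩
    by_cases hGH : SameNames G.support H.support
    · exact elem_eq_of_tracePairing
        (tracePairing_conj_eq_of_partialTrace_eq (h _ (isNamePreserving_ketBra hGH)) hA')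
    · classical
      -- With equal complements, different names of `G` and `H` force different names of the
      -- restrictions, so the right side vanishes too.
      rw [hB G H hGH, braket_eq]
      split_ifs with hc
      · rw [hB _ _ fun h' => hGH ((χ.sameNames_iff_of_compl_eq hc.symm).2 h'), zero_mul]
      · rw [mul_zero]
  · refine Subtype.ext (op_ext fun X Y => ?_)
    by_cases hXY : SameNames X.support Y.support
    · exact elem_partialTrace_conj_eq
        (h _ ⟨ζ.isNamePreserving_dualOp hXY, ζ.isLocal_dualOp X Y⟩).2 ρ
    -- Here the dual operator is not available as a name-preserving observable, but both partial
    -- traces are name-preserving and vanish at `(X, Y)`.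
    · have key : ∀ τ : TraceClass (Graph K S), IsNamePreserving τ.1 →
          elem (partialTrace ζ (conj U τ)).1 X Y = 0 := fun τ hτ =>
        isNamePreserving_partialTrace ζ (ρ := conj U τ) ((hU.mul hτ).mul hU.star) Y X
          fun h' => hXY h'.symm
      rw [key ρ hρ, key _ (isNamePreserving_partialTrace χ hρ)]

/-- The inner factor `U U†` cancels, so `A ↦ U† A U` respects products as well as adjoints. -/
theorem star_conj_mul_conj (hU : U * star U = 1) (A : Op (Graph K S)) :
    star (star U * A * U) * (star U * A * U) = star U * (star A * A) * U ∧
      (star U * A * U) * star (star U * A * U) = star U * (A * star A) * U := by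
  have h : ∀ B C : Op (Graph K S), (star U * B * U) * (star U * C * U) = star U * (B * C) * U :=
    fun B C => by
      calc (star U * B * U) * (star U * C * U) = star U * B * (U * star U) * C * U := by
            simp only [mul_assoc]
        _ = star U * (B * C) * U := by rw [hU, mul_one]; simp only [mul_assoc]
  have hs : star (star U * A * U) = star U * star A * U := by
    simp only [star_mul, star_star, mul_assoc]
  rw [hs]
  exact ⟨h _ _, h _ _⟩

end Causality

end QNet

end

theorem mainTheorem3 {K S : Type*} [Countable K] (χ ζ : QNet.Restriction K S)
    (U : QNet.Op (QNet.Graph K S)) :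
    (QNet.IsCausal χ ζ U ↔
      ∀ A : QNet.Op (QNet.Graph K S), QNet.IsLocal ζ A → QNet.IsLocal χ (star U * A * U)) ∧
    (QNet.IsNPCausal χ ζ U ↔
      QNet.IsNamePreserving U ∧
        ∀ A : QNet.Op (QNet.Graph K S), QNet.IsNamePreserving A ∧ QNet.IsLocal ζ A →
          QNet.IsNamePreserving (star U * A * U) ∧ QNet.IsLocal χ (star U * A * U)) ∧
    (U ∈ unitary (QNet.Op (QNet.Graph K S)) → QNet.IsCausal χ ζ U →
      ∀ A : QNet.Op (QNet.Graph K S), QNet.IsStrictlyLocal ζ A →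
        QNet.IsStrictlyLocal χ (star U * A * U)) ∧
    (U ∈ unitary (QNet.Op (QNet.Graph K S)) → QNet.IsNPCausal χ ζ U →
      ∀ A : QNet.Op (QNet.Graph K S), QNet.IsNamePreserving A ∧ QNet.IsStrictlyLocal ζ A →
        QNet.IsNamePreserving (star U * A * U) ∧ QNet.IsStrictlyLocal χ (star U * A * U)) := by
  refine ⟨QNet.isCausal_iff, QNet.isNPCausal_iff, fun hU h A hA => ?_,
    fun hU h A ⟨hN, hA⟩ => ?_⟩
  · rw [QNet.isCausal_iff] at h
    obtain ⟨h₁, h₂⟩ := QNet.star_conj_mul_conj (Unitary.mul_star_self_of_mem hU) A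
    refine ⟨h _ hA.1, ?_, ?_⟩
    · rw [h₁]
      exact h _ hA.2.1
    · rw [h₂]
      exact h _ hA.2.2
  · rw [QNet.isNPCausal_iff] at h
    obtain ⟨h₁, h₂⟩ := QNet.star_conj_mul_conj (Unitary.mul_star_self_of_mem hU) A
    refine ⟨(h.2 _ ⟨hN, hA.1⟩).1, (h.2 _ ⟨hN, hA.1⟩).2, ?_, ?_⟩
    · rw [h₁]
      -- The second part applies to `A† A` because products and adjoints of name-preserving
      -- operators are name-preserving.
      exact (h.2 _ ⟨hN.star.mul hN, hA.2.1⟩).2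
    · rw [h₂]
      exact (h.2 _ ⟨hN.mul hN.star, hA.2.2⟩).2
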